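/- Fix integers $1\le r\le K$ and $T\ge 1$ and a real $\gamma>2$. **Random graph.** Let $d_1,\dots,d_n$ be i.i.d. with density $(\gamma-1)x^{-\gamma}$ on $[1,\infty)$ (so that $\mathbb E[d_1]=\frac{\gamma-1}{\gamma-2}$) and put $\rho=1/\sum_{k=1}^n d_k$. Given $d_1,\dots,d_n$, every unordered pair $\{i,j\}$ of vertices in $[n]$ ($i=j$ allowed) is, independently of the others, an edge of the undirected graph $\mathcal G$ with probability $\min(1,\rho\, d_id_j)$. This is the power law model $\mathrm{PL}(n,\gamma,\rho)$. **Allocations.** An allocation $A\in\mathcal A_n(r)$ consists of sets $\mathcal M_1,\dots,\mathcal M_K\subseteq[n]$ covering $[n]$ with $\sum_k|\mathcal M_k|=rn$, and a partition $[n]=\mathcal R_1\sqcup\dots\sqcup\mathcal R_K$, such that the sizes $|\mathcal M_k|$ differ from each other by at most $1$ and so do the sizes $|\mathcal R_k|$ (hence $|\mathcal M_k|=rn/K$ and $|\mathcal R_k|=n/K$ if $K\mid n$). **Loads.** For a graph $G$ and an allocation $A$, there is a $T$-bit intermediate value $v_{i,j}$ for every ordered pair $(i,j)$ with $\{i,j\}$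 an edge of $G$. Machine $k$ knows the $v_{i,j}$ with $j\in\mathcal M_k$ and needs the $v_{i,j}$ with $i\in\mathcal R_k$, $j\notin\mathcal M_k$. In a feasible shuffling scheme each machine $k$ multicasts $c_k$ bits, a function of the values it knows, such that for all possible values $(v_{i,j})$ every machine recovers the values it needs from the values it knows and the messages of the other machines; the load of the scheme is $\frac{1}{n^2T}\sum_k c_k$. Let $L_A(r,G)$ be the minimum load of a feasible scheme, let $L^{\mathrm{UC}}_A(r,G)=\frac1{n^2}\sum_k\#\{(i,j): \{i,j\}\in G,\ i\in\mathcal R_k,\ j\notin\mathcal M_k\}$ be the load of uncoded shuffling (every needed value is sent on its own), and let $$L^*(r)=\inf_{A\in\mathcal A_n(r)}\mathbb E_{\mathcal G}\big[L_A(r,\mathcal G)\big].$$ **Theorem.** $$\limsup_{n\to\infty}\frac{n\,L^*(r)}{\left(\frac{\gamma-1}{\gamma-2}\right)}\ \le\ \frac1r\Big(1-\frac rK\Big),$$ whereas for every sequence of allocations $A_n\in\mathcal A_n(r)$ the average uncoded load satisfies $$\lim_{n\to\infty} n\,\mathbb E_{\mathcal G}\big[L^{\mathrm{UC}}_{A_n}(r,\mathcal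 G)\big]=\Big(1-\frac rK\Big)\frac{\gamma-1}{\gamma-2}.$$ -/

import Mathlib

open MeasureTheory ProbabilityTheory Filter Topology
open scoped ENNReal

namespace CodedGraph

/-! ### Random graphs -/

/-- Undirected graphs on the vertex set `Fin n`, with self-loops allowed: a graph records for each
unordered pair `s(i, j)` (with `i = j` allowed) whether it is an edge. -/
abbrev LoopGraph (n : ℕ) : Type := Sym2 (Fin n) → Bool

/-- `j` is a neighbour of `i` in `G`. -/
def LoopGraph.Adj {n : ℕ} (G : LoopGraph n) (i j : Fin n) : Prop := G s(i, j) = true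

/-- The law of the expected degree sequence: `d_1, …, d_n` are independent, each with the power law
density `(γ - 1) x ^ (-γ)` on `[1, ∞)`. -/
noncomputable def degreeLaw (n : ℕ) (γ : ℝ) : Measure (Fin n → ℝ) :=
  Measure.pi fun _ => paretoMeasure 1 (γ - 1)

/-- The normalizing factor `ρ = 1 / (d_1 + ⋯ + d_n)`. -/
noncomputable def rho {n : ℕ} (d : Fin n → ℝ) : ℝ := (∑ k, d k)⁻¹

/-- The product `d_i d_j` as a function of the unordered pair `s(i, j)`. -/
def degreeProd {n : ℕ} (d : Fin n → ℝ) : Sym2 (Fin n) → ℝ :=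
  Sym2.lift ⟨fun i j => d i * d j, fun i j => mul_comm (d i) (d j)⟩

/-- The probability of the edge `s(i, j)` given the expected degrees: `ρ d_i d_j`, capped at `1`
(for positive degrees, `min 1 (ρ d_i d_j)`). -/
noncomputable def edgeProb {n : ℕ} (d : Fin n → ℝ) (e : Sym2 (Fin n)) : unitInterval :=
  Set.projIcc 0 1 zero_le_one (rho d * degreeProd d e)

/-- The law of the graph given the expected degrees: every edge `e` is present with probability
`edgeProb d e`, independently of all other edges. -/
noncomputable def edgeLaw {n : ℕ} (d : Fin n → ℝ) : Measure (LoopGraph n) :=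
  Measure.pi fun e => bernoulliMeasure true false (edgeProb d e)

/-- The law of the power law random graph on `n` vertices: first draw the expected degrees, then the
edges. -/
noncomputable def powerLawGraph (n : ℕ) (γ : ℝ) : Measure (LoopGraph n) :=
  (degreeLaw n γ).bind edgeLaw

instance {n : ℕ} (d : Fin n → ℝ) : IsProbabilityMeasure (edgeLaw d) := by
  unfold edgeLaw; infer_instance

lemma measurable_edgeProb {n : ℕ} (e : Sym2 (Fin n)) :
    Measurable fun d : Fin n → ℝ => edgeProb d e := by
  have h : Measurable fun d : Fin n → ℝ => rho d * degreeProd d e := by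
    refine Measurable.mul ?_ ?_
    · unfold rho; fun_prop
    · induction e with
      | h i j => simp only [degreeProd, Sym2.lift_mk]; fun_prop
  exact continuous_projIcc.measurable.comp h

/-- The conditional law of the graph depends measurably on the degrees, so that `powerLawGraph` is
a genuine mixture. -/
lemma measurable_edgeLaw {n : ℕ} :
    Measurable (edgeLaw : (Fin n → ℝ) → Measure (LoopGraph n)) := by
  classical
  refine Measure.measurable_of_measurable_coe _ fun s _ => ?_
  have hs : ∀ d : Fin n → ℝ, edgeLaw d s
      = ∑ G ∈ s.toFinset, ∏ e, bernoulliMeasure true false (edgeProb d e) {G e} := by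
    intro d
    rw [← Set.coe_toFinset s, ← sum_measure_singleton]
    simp [edgeLaw]
  simp_rw [hs]
  refine Finset.measurable_sum _ fun G _ => Finset.measurable_prod _ fun e _ => ?_
  have h := measurable_edgeProb e
  cases hG : G e
  · simp only [bernoulliMeasure_apply _ (measurableSet_singleton _)]
    simp only [Set.mem_singleton_iff, Bool.true_eq_false, if_true, if_false]
    exact ((unitInterval.continuous_symm.measurable.comp h).subtype_val.subtype_mk).coe_nnreal_ennreal
  · simp only [bernoulliMeasure_apply _ (measurableSet_singleton _)]
    simp only [Set.mem_singleton_iff, Bool.false_eq_true, if_true, if_false]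
    exact (h.subtype_val.subtype_mk).coe_nnreal_ennreal

lemma isProbabilityMeasure_powerLawGraph (n : ℕ) {γ : ℝ} (hγ : 1 < γ) :
    IsProbabilityMeasure (powerLawGraph n γ) := by
  have := isProbabilityMeasure_paretoMeasure one_pos (sub_pos.2 hγ)
  refine ⟨?_⟩
  rw [powerLawGraph, Measure.bind_apply MeasurableSet.univ measurable_edgeLaw.aemeasurable]
  simp [degreeLaw]

/-! ### Distributed computation -/

/-- A subgraph and computation allocation of `n` vertices to `K` machines with computation load `r`.
Machine `k` Maps the vertices in `map k` and Reduces the vertices in `reduce k`. Every vertex is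
Mapped by some machine, the computation load `∑ k, |map k| / n` is `r`, every vertex is Reduced by
exactly one machine, and the machines share both tasks equally: the sizes differ by at most one, so
that `|map k| = r n / K` and `|reduce k| = n / K` whenever `K` divides `n`. -/
structure Allocation (n K r : ℕ) where
  map : Fin K → Finset (Fin n)
  reduce : Fin K → Finset (Fin n)
  map_cover : ∀ i, ∃ k, i ∈ map k
  map_load : ∑ k, (map k).card = r * n
  map_equal : ∀ k l, (map k).card ≤ (map l).card + 1
  reduce_partition : ∀ i, ∃! k, i ∈ reduce k
  reduce_equal : ∀ k l, (reduce k).card ≤ (reduce l).card + 1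

variable {n K r : ℕ}

/-- The ordered pairs `(i, j)` for which there is an intermediate value `v_{i,j}`, which is computed
by Mapping `j` and is needed for Reducing `i`. -/
def ValueIdx (G : LoopGraph n) : Set (Fin n × Fin n) := {p | G.Adj p.1 p.2}

/-- The indices of the intermediate values that machine `k` computes locally in the Map phase. -/
def LocalIdx (G : LoopGraph n) (A : Allocation n K r) (k : Fin K) : Set (Fin n × Fin n) :=
  {p | p ∈ ValueIdx G ∧ p.2 ∈ A.map k}

/-- The indices of the intermediate values that machine `k` has to recover in the Shuffle phase. -/
def NeededIdx (G : LoopGraph n) (A : Allocation n K r) (k : Fin K) : Set (Fin n × Fin n) :=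
  {p | p ∈ ValueIdx G ∧ p.1 ∈ A.reduce k ∧ p.2 ∉ A.map k}

/-- Binary words of length `T`. -/
abbrev Word (T : ℕ) : Type := Fin T → Bool

/-- A feasible Shuffling coding scheme for intermediate values of `T` bits, given the graph `G` and
the allocation `A`. Machine `k` multicasts a message of `len k` bits, computed from its local
intermediate values; from these and the messages of the other machines, every machine recovers all
the intermediate values it needs, whatever the intermediate values are. -/
structure ShuffleScheme (G : LoopGraph n) (A : Allocation n K r) (T : ℕ) where
  len : Fin K → ℕ
  encode : ∀ k, (LocalIdx G A k → Word T) → Word (len k)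
  decode : ∀ k, (LocalIdx G A k → Word T) → (∀ l, l ≠ k → Word (len l)) →
    NeededIdx G A k → Word T
  correct : ∀ (v : ValueIdx G → Word T) (k : Fin K),
    decode k (fun p => v ⟨p.1, p.2.1⟩) (fun l _ => encode l fun p => v ⟨p.1, p.2.1⟩)
      = fun p => v ⟨p.1, p.2.1⟩

/-- The normalized communication load of `b` bits: `b / (n² T)`. -/
noncomputable def normalizedLoad (n T b : ℕ) : ℝ≥0∞ := (b : ℝ≥0∞) / ((n : ℝ≥0∞) ^ 2 * T)

/-- `L_A(r, G)`: the minimum normalized communication load over all feasible Shuffling schemes. -/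
noncomputable def minLoad (T : ℕ) (A : Allocation n K r) (G : LoopGraph n) : ℝ≥0∞ :=
  ⨅ S : ShuffleScheme G A T, normalizedLoad n T (∑ k, S.len k)

/-- The normalized communication load of uncoded Shuffling, in which every needed intermediate value
is sent on its own. -/
noncomputable def uncodedLoad (T : ℕ) (A : Allocation n K r) (G : LoopGraph n) : ℝ≥0∞ :=
  normalizedLoad n T (∑ k, (NeededIdx G A k).ncard * T)

/-- `L*(r)`: the minimum, over all allocations with computation load `r`, of the average of
`L_A(r, G)` when the graph `G` has law `μ`. -/
noncomputable def minAverageLoad (K r T : ℕ) (μ : Measure (LoopGraph n)) : ℝ≥0∞ :=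
  ⨅ A : Allocation n K r, ∫⁻ G, minLoad T A G ∂μ

end CodedGraph

/-!
If every vertex is Mapped by exactly `r` machines, then each value needed by a machine `k` belongs
to a set `S ∋ k` of `r + 1` machines, all of which know it except `k`. A machine of `S` multicasts
sums of one bit for each of the `r` others; every receiver knows all the other summands, so one bit
serves `r` machines. The cost is `(r + 1) / r` times the largest of the `r + 1` numbers of needed
values, and the gain over uncoded Shuffling is `r` as soon as these numbers are nearly equal.

They are: for deterministic `R, B ⊆ [n]`, the number of edges between `R` and `B` is
`|R| |B| 𝔼[d₁] / n + o(n)` in `L¹`. Given the degrees, its variance is at most twice its mean, which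
is at most `∑ dᵢ`. Capping the edge probabilities at `1` loses at most twice the sum of the excesses
of the degrees over a level `M`, plus `M²`, so an integrable degree law suffices. What remains is
the `L¹` law of large numbers for the degrees in `R`, in `B` and in `[n]`.
-/

namespace CodedGraph

open scoped Finset

section Schemes

variable {n K r T : ℕ} {G : LoopGraph n} {A : Allocation n K r}

/-- The intermediate values computed locally by machine `k`, out of all intermediate values. -/
def localValues (A : Allocation n K r) (k : Fin K) (v : ValueIdx G → Word T) :
    LocalIdx G A k → Word T :=
  fun p => v ⟨p.1, p.2.1⟩

/-- The intermediate values needed by machine `k`, out of all intermediate values. -/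
def neededValues (A : Allocation n K r) (k : Fin K) (v : ValueIdx G → Word T) :
    NeededIdx G A k → Word T :=
  fun p => v ⟨p.1, p.2.1⟩

lemma exists_shuffleScheme_of_determines (len : Fin K → ℕ)
    (encode : ∀ k, (LocalIdx G A k → Word T) → Word (len k))
    (determines : ∀ k (v v' : ValueIdx G → Word T), localValues A k v = localValues A k v' →
      (∀ l ≠ k, encode l (localValues A l v) = encode l (localValues A l v')) →
      neededValues A k v = neededValues A k v') :
    ∃ S : ShuffleScheme G A T, S.len = len := by
  let received (k : Fin K) (v : ValueIdx G → Word T) :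
      (LocalIdx G A k → Word T) × (∀ l, l ≠ k → Word (len l)) :=
    (localValues A k v, fun l _ => encode l (localValues A l v))
  have factors (k : Fin K) : (neededValues A k).FactorsThrough (received k) := fun v v' h =>
    determines k v v' (congrArg Prod.fst h) fun l hl =>
      congrFun (congrFun (congrArg Prod.snd h) l) hl
  exact ⟨{ len := len
           encode := encode
           decode := fun k u w => Function.extend (received k) (neededValues A k) default (u, w)
           correct := fun v k => (factors k).extend_apply default v }, rfl⟩

/-- Index coding: the bit multicast in a slot is the sum of the needed bits assigned to that slot,
and its receiver already knows all of these but one. -/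
lemma exists_shuffleScheme_of_slots {σ : Type*} (X : Finset σ) (sender : σ → Fin K)
    (slot : (Fin n × Fin n) × Fin T → σ)
    (slot_mem : ∀ k q, q.1 ∈ NeededIdx G A k → slot q ∈ X)
    (sender_knows : ∀ k q, q.1 ∈ NeededIdx G A k → q.1 ∈ LocalIdx G A (sender (slot q)))
    (receiver_knows : ∀ k l q q', q.1 ∈ NeededIdx G A k → q'.1 ∈ NeededIdx G A l →
      slot q' = slot q → q' ≠ q → q'.1 ∈ LocalIdx G A k) :
    ∃ S : ShuffleScheme G A T, ∑ k, S.len k = #X := by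
  classical
  let terms (s : Fin K) (x : σ) : Finset (LocalIdx G A s × Fin T) :=
    {q | slot (q.1, q.2) = x ∧ ∃ l, q.1.1 ∈ NeededIdx G A l}
  let slots (s : Fin K) : Finset σ := {x ∈ X | sender x = s}
  obtain ⟨S, hS⟩ := exists_shuffleScheme_of_determines (A := A) (fun s => #(slots s))
    (fun s u c => ∑ q ∈ terms s ((slots s).equivFin.symm c), u q.1 q.2) (by
      intro k v v' hlocal hmessage
      funext ⟨p, hp⟩ b
      set x := slot (p, b) with hx
      have hps : p ∈ LocalIdx G A (sender x) := sender_knows k (p, b) hp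
      have hxs : x ∈ slots (sender x) := by simpa [slots] using slot_mem k (p, b) hp
      have hsum := congrFun (hmessage (sender x) fun h => hp.2.2 (h ▸ hps.2))
        ((slots (sender x)).equivFin ⟨x, hxs⟩)
      have hpx : (⟨p, hps⟩, b) ∈ terms (sender x) x := by
        simpa [terms, ← hx] using ⟨k, hp⟩
      have hrest : ∑ q ∈ (terms (sender x) x).erase (⟨p, hps⟩, b),
            localValues A (sender x) v q.1 q.2
          = ∑ q ∈ (terms (sender x) x).erase (⟨p, hps⟩, b),
            localValues A (sender x) v' q.1 q.2 := by
        refine Finset.sum_congr rfl fun ⟨q, c⟩ hq => ?_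
        obtain ⟨hne, hslot, l, hl⟩ := by simpa only [Finset.mem_erase, terms,
          Finset.mem_filter, Finset.mem_univ, true_and] using hq
        have hk := receiver_knows k l (p, b) (q, c) hp hl hslot
          (fun h => hne (by simpa [Subtype.ext_iff] using h))
        exact congrFun (congrFun hlocal ⟨q, hk⟩) c
      simp only [Equiv.symm_apply_apply] at hsum
      rw [← Finset.add_sum_erase _ _ hpx, ← Finset.add_sum_erase _ _ hpx, hrest] at hsum
      exact add_right_cancel hsum)
  refine ⟨S, ?_⟩
  rw [hS, ← Finset.card_eq_sum_card_fiberwise fun x _ => Finset.mem_coe.2 (Finset.mem_univ _)]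

/-- The machine that Reduces vertex `i`. -/
noncomputable def Allocation.reducer (A : Allocation n K r) (i : Fin n) : Fin K :=
  (A.reduce_partition i).choose

/-- The machines that Map vertex `j`. -/
def Allocation.mappers (A : Allocation n K r) (j : Fin n) : Finset (Fin K) :=
  {k | j ∈ A.map k}

/-- The batch of the set `S` of machines: the vertices Mapped by exactly the machines of `S`. -/
def Allocation.batch (A : Allocation n K r) (S : Finset (Fin K)) : Finset (Fin n) :=
  {j | A.mappers j = S}

/-- The ordered pairs in `R ×ˢ B` that are joined by an edge of `G`. -/
def edgesBetween (G : LoopGraph n) (R B : Finset (Fin n)) : Finset (Fin n × Fin n) :=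
  {p ∈ R ×ˢ B | G s(p.1, p.2) = true}

lemma Allocation.mem_reduce_iff {i : Fin n} {k : Fin K} : i ∈ A.reduce k ↔ A.reducer i = k :=
  ⟨fun h => ((A.reduce_partition i).choose_spec.2 k h).symm,
    fun h => h ▸ (A.reduce_partition i).choose_spec.1⟩

lemma Allocation.mem_mappers {j : Fin n} {k : Fin K} : k ∈ A.mappers j ↔ j ∈ A.map k := by
  simp [mappers]

lemma mem_neededIdx_iff {k : Fin K} {i j : Fin n} :
    (i, j) ∈ NeededIdx G A k ↔ G s(i, j) = true ∧ A.reducer i = k ∧ k ∉ A.mappers j := by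
  rw [A.mem_mappers, ← A.mem_reduce_iff]; rfl

lemma mem_localIdx_iff {k : Fin K} {i j : Fin n} :
    (i, j) ∈ LocalIdx G A k ↔ G s(i, j) = true ∧ k ∈ A.mappers j := by
  rw [A.mem_mappers]; rfl

/-- The machines involved in a value `v_{i,j}`: the Reducer of `i` and the Mappers of `j`. -/
noncomputable def Allocation.group (A : Allocation n K r) (p : Fin n × Fin n) : Finset (Fin K) :=
  insert (A.reducer p.1) (A.mappers p.2)

lemma mem_group_of_mem_neededIdx {k : Fin K} {p : Fin n × Fin n} (hp : p ∈ NeededIdx G A k) :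
    k ∈ A.group p :=
  (mem_neededIdx_iff.1 hp).2.1 ▸ Finset.mem_insert_self _ _

lemma group_erase_of_mem_neededIdx {k : Fin K} {p : Fin n × Fin n} (hp : p ∈ NeededIdx G A k) :
    (A.group p).erase k = A.mappers p.2 := by
  obtain ⟨-, rfl, hk⟩ := mem_neededIdx_iff.1 hp
  exact Finset.erase_insert hk

lemma card_group_of_mem_neededIdx {k : Fin K} {p : Fin n × Fin n} (hp : p ∈ NeededIdx G A k) :
    #(A.group p) = #(A.mappers p.2) + 1 := by
  rw [← group_erase_of_mem_neededIdx hp,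
    Finset.card_erase_add_one (mem_group_of_mem_neededIdx hp)]

lemma mem_edgesBetween_of_mem_neededIdx {k : Fin K} {p : Fin n × Fin n}
    (hp : p ∈ NeededIdx G A k) :
    p ∈ edgesBetween G (A.reduce k) (A.batch ((A.group p).erase k)) := by
  rw [group_erase_of_mem_neededIdx hp]
  simpa [edgesBetween, Allocation.batch] using ⟨hp.2.1, hp.1⟩

lemma exists_mapsTo_injOn_product_range {α β : Type*} [Nonempty β] {s : Finset α} {t : Finset β}
    {m : ℕ} (h : #s ≤ #t * m) :
    ∃ f : α → β × ℕ, Set.MapsTo f s (t ×ˢ Finset.range m : Finset (β × ℕ)) ∧ Set.InjOn f s := by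
  have henc : (s : Set α).encard ≤
      ((t ×ˢ Finset.range m : Finset (β × ℕ)) : Set (β × ℕ)).encard := by
    rw [Set.encard_coe_eq_coe_finsetCard, Set.encard_coe_eq_coe_finsetCard, Finset.card_product,
      Finset.card_range]
    exact_mod_cast h
  exact s.finite_toSet.exists_injOn_of_encard_le henc

/-- The bits needed by machine `k` that are known to exactly the other machines of `S`. -/
def batchBits (G : LoopGraph n) (A : Allocation n K r) (T : ℕ) (S : Finset (Fin K)) (k : Fin K) :
    Finset ((Fin n × Fin n) × Fin T) :=
  edgesBetween G (A.reduce k) (A.batch (S.erase k)) ×ˢ Finset.univ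

lemma mem_batchBits_of_mem_neededIdx {k : Fin K} {q : (Fin n × Fin n) × Fin T}
    (hq : q.1 ∈ NeededIdx G A k) : q ∈ batchBits G A T (A.group q.1) k :=
  Finset.mem_product.2 ⟨mem_edgesBetween_of_mem_neededIdx hq, Finset.mem_univ _⟩

lemma exists_mapsTo_injOn_batchBits {len : Finset (Fin K) → ℕ}
    (hlen : ∀ S : Finset (Fin K), #S = r + 1 → ∀ k ∈ S,
      #(edgesBetween G (A.reduce k) (A.batch (S.erase k))) * T ≤ r * len S) :
    ∃ f : Finset (Fin K) → Fin K → (Fin n × Fin n) × Fin T → Fin K × ℕ,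
      ∀ S k, #S = r + 1 ∧ k ∈ S →
        Set.MapsTo (f S k) (batchBits G A T S k)
          (S.erase k ×ˢ Finset.range (len S) : Finset (Fin K × ℕ)) ∧
        Set.InjOn (f S k) (batchBits G A T S k) := by
  have exists_slots (S : Finset (Fin K)) (k : Fin K) (hS : #S = r + 1 ∧ k ∈ S) :
      ∃ f : (Fin n × Fin n) × Fin T → Fin K × ℕ,
        Set.MapsTo f (batchBits G A T S k)
          (S.erase k ×ˢ Finset.range (len S) : Finset (Fin K × ℕ)) ∧
        Set.InjOn f (batchBits G A T S k) := by
    have : Nonempty (Fin K) := ⟨k⟩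
    refine exists_mapsTo_injOn_product_range ?_
    simpa [batchBits, Finset.card_erase_of_mem hS.2, hS.1] using hlen S hS.1 k hS.2
  choose! f hf using exists_slots
  exact ⟨f, hf⟩

/-- A set `S` of `r + 1` machines is used as follows: a value needed by `k ∈ S` and Mapped by all
other machines of `S` is sent by one of the latter, which share this work equally. -/
lemma exists_shuffleScheme_of_batches (hA : ∀ j, #(A.mappers j) = r)
    (len : Finset (Fin K) → ℕ)
    (hlen : ∀ S : Finset (Fin K), #S = r + 1 → ∀ k ∈ S,
      #(edgesBetween G (A.reduce k) (A.batch (S.erase k))) * T ≤ r * len S) :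
    ∃ S : ShuffleScheme G A T,
      ∑ k, S.len k = ∑ S ∈ Finset.univ.powersetCard (r + 1), (r + 1) * len S := by
  obtain ⟨f, hf⟩ := exists_mapsTo_injOn_batchBits hlen
  let slot (q : (Fin n × Fin n) × Fin T) : Σ _ : Finset (Fin K), Fin K × ℕ :=
    ⟨A.group q.1, f (A.group q.1) (A.reducer q.1.1) q⟩
  let X : Finset (Σ _ : Finset (Fin K), Fin K × ℕ) :=
    (Finset.univ.powersetCard (r + 1)).sigma fun S => S ×ˢ Finset.range (len S)
  have group_spec {k p} (hp : p ∈ NeededIdx G A k) : #(A.group p) = r + 1 ∧ k ∈ A.group p :=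
    ⟨by rw [card_group_of_mem_neededIdx hp, hA], mem_group_of_mem_neededIdx hp⟩
  have slot_spec {k q} (hq : q.1 ∈ NeededIdx G A k) :
      (slot q).2.1 ∈ A.mappers q.1.2 ∧ (slot q).2.2 < len (A.group q.1) := by
    have h := (hf _ _ (group_spec hq)).1 (mem_batchBits_of_mem_neededIdx hq)
    rw [Finset.mem_coe, Finset.mem_product, group_erase_of_mem_neededIdx hq, Finset.mem_range] at h
    rwa [← (mem_neededIdx_iff.1 hq).2.1] at h
  obtain ⟨S, hS⟩ := exists_shuffleScheme_of_slots (G := G) (A := A) X (fun x => x.2.1) slot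
    (fun k q hq => by
      simpa [X, slot, (group_spec hq).1] using
        ⟨Finset.mem_insert_of_mem (slot_spec hq).1, (slot_spec hq).2⟩)
    (fun k q hq => mem_localIdx_iff.2 ⟨hq.1, (slot_spec hq).1⟩)
    (fun k l q q' hq hq' hslot hne => by
      obtain ⟨hgroup, hslot'⟩ := Sigma.mk.inj_iff.1 hslot
      obtain ⟨-, hk, -⟩ := mem_neededIdx_iff.1 hq
      obtain ⟨-, hl, -⟩ := mem_neededIdx_iff.1 hq'
      rw [hgroup, hk, hl] at hslot'
      have hkl : k ≠ l := by
        rintro rfl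
        exact hne ((hf _ _ (group_spec hq)).2 (hgroup ▸ mem_batchBits_of_mem_neededIdx hq')
          (mem_batchBits_of_mem_neededIdx hq) (eq_of_heq hslot'))
      exact mem_localIdx_iff.2 ⟨hq'.1, group_erase_of_mem_neededIdx hq' ▸
        Finset.mem_erase.2 ⟨hkl, hgroup ▸ mem_group_of_mem_neededIdx hq⟩⟩)
  refine ⟨S, hS.trans ?_⟩
  rw [Finset.card_sigma]
  refine Finset.sum_congr rfl fun S hS => ?_
  rw [Finset.card_product, Finset.card_range, (Finset.mem_powersetCard.1 hS).2]

lemma normalizedLoad_eq_ofReal (hn : 0 < n) (hT : 0 < T) (b : ℕ) :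
    normalizedLoad n T b = ENNReal.ofReal (b / ((n : ℝ) ^ 2 * T)) := by
  rw [normalizedLoad, ENNReal.ofReal_div_of_pos (by positivity), ENNReal.ofReal_natCast,
    ENNReal.ofReal_mul (by positivity), ENNReal.ofReal_pow (by positivity), ENNReal.ofReal_natCast,
    ENNReal.ofReal_natCast]

lemma minLoad_le_of_card_edgesBetween_le (hn : 0 < n) (hT : 0 < T) (hr : 0 < r)
    (hA : ∀ j, #(A.mappers j) = r) (N : Finset (Fin K) → ℝ)
    (hN : ∀ S : Finset (Fin K), #S = r + 1 → ∀ k ∈ S,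
      (#(edgesBetween G (A.reduce k) (A.batch (S.erase k))) : ℝ) ≤ N S) :
    minLoad T A G ≤ ENNReal.ofReal
      ((r + 1) / r * (∑ S ∈ Finset.univ.powersetCard (r + 1), (N S + r)) / (n : ℝ) ^ 2) := by
  have hT' : (1 : ℝ) ≤ T := mod_cast hT
  have hr' : (0 : ℝ) < r := mod_cast hr
  let len (S : Finset (Fin K)) : ℕ := ⌈N S * T / r⌉₊
  have hlen (S : Finset (Fin K)) (hS : #S = r + 1) (k : Fin K) (hk : k ∈ S) :
      #(edgesBetween G (A.reduce k) (A.batch (S.erase k))) * T ≤ r * len S := by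
    have h := Nat.le_ceil (N S * T / r)
    rw [div_le_iff₀' hr'] at h
    exact_mod_cast (mul_le_mul_of_nonneg_right (hN S hS k hk) (by positivity)).trans h
  have len_le (S : Finset (Fin K)) (hS : S ∈ Finset.univ.powersetCard (r + 1)) :
      (len S : ℝ) ≤ T / r * (N S + r) := by
    have hcard := (Finset.mem_powersetCard.1 hS).2
    obtain ⟨k, hk⟩ : S.Nonempty := Finset.card_pos.1 (hcard ▸ Nat.succ_pos r)
    have hNS : 0 ≤ N S := (Nat.cast_nonneg _).trans (hN S hcard k hk)
    calc (len S : ℝ) ≤ N S * T / r + 1 := (Nat.ceil_lt_add_one (by positivity)).le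
      _ ≤ N S * T / r + T := by gcongr
      _ = T / r * (N S + r) := by field_simp
  obtain ⟨S, hS⟩ := exists_shuffleScheme_of_batches hA len hlen
  refine (iInf_le _ S).trans ?_
  rw [normalizedLoad_eq_ofReal hn hT, hS]
  refine ENNReal.ofReal_le_ofReal ?_
  rw [← Finset.mul_sum, Nat.cast_mul, Nat.cast_sum]
  calc ((r + 1 : ℕ) : ℝ) * (∑ S ∈ Finset.univ.powersetCard (r + 1), (len S : ℝ)) / (n ^ 2 * T)
      ≤ (r + 1 : ℕ) * (∑ S ∈ Finset.univ.powersetCard (r + 1), T / r * (N S + r))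
          / (n ^ 2 * T) := by
        gcongr with S hS
        exact len_le S hS
    _ = _ := by rw [← Finset.mul_sum]; push_cast; field_simp

end Schemes

section Balanced

variable {α : Type*} [Fintype α] {r : ℕ}

lemma exists_card_eq_forall_notMem_le (c : α → ℕ) (hr : r ≤ Fintype.card α) :
    ∃ U : Finset α, #U = r ∧ ∀ k ∈ U, ∀ l ∉ U, c k ≤ c l := by
  classical
  induction r with
  | zero => exact ⟨∅, rfl, by simp⟩
  | succ r ih =>
    obtain ⟨U, hU, hle⟩ := ih (Nat.le_of_succ_le hr)
    obtain ⟨a, ha, hmin⟩ := Finset.exists_min_image Uᶜ c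
      (Finset.card_pos.1 (by rw [Finset.card_compl]; lia))
    rw [Finset.mem_compl] at ha
    refine ⟨insert a U, by rw [Finset.card_insert_of_notMem ha, hU], fun k hk l hl => ?_⟩
    rw [Finset.mem_insert, not_or] at hl
    rcases Finset.mem_insert.1 hk with rfl | hk
    · exact hmin l (Finset.mem_compl.2 hl.2)
    · exact hle k hk l hl.2

variable [DecidableEq α]

/-- Greedy choice: every new set consists of points that have been covered least often so far. -/
lemma exists_multiset_countP_mem_le_add_one (hr : r ≤ Fintype.card α) (s : ℕ) :
    ∃ m : Multiset (Finset α), m.card = s ∧ (∀ U ∈ m, #U = r) ∧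
      ∀ k l, m.countP (k ∈ ·) ≤ m.countP (l ∈ ·) + 1 := by
  induction s with
  | zero => exact ⟨0, by simp⟩
  | succ s ih =>
    obtain ⟨m, hcard, hm, hbal⟩ := ih
    obtain ⟨U, hU, hle⟩ := exists_card_eq_forall_notMem_le (fun k => m.countP (k ∈ ·)) hr
    refine ⟨U ::ₘ m, by rw [Multiset.card_cons, hcard], by simpa [hU] using hm, fun k l => ?_⟩
    rw [Multiset.countP_cons, Multiset.countP_cons]
    have hkl := hbal k l
    by_cases hk : k ∈ U <;> by_cases hl : l ∈ U
    · simpa [hk, hl] using hkl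
    · simpa [hk, hl] using hle k hk l hl
    · simpa [hk, hl] using hkl.trans (Nat.le_succ _)
    · simpa [hk, hl] using hkl

lemma card_filter_mem_powersetCard_univ_eq (k l : α) :
    #{U ∈ Finset.univ.powersetCard r | k ∈ U} = #{U ∈ Finset.univ.powersetCard r | l ∈ U} := by
  rcases Nat.eq_zero_or_pos r with rfl | hr
  · simp [Finset.filter_singleton]
  · have h (a : α) := Finset.card_filter_powersetCard_subset {a} Finset.univ r
      (Finset.subset_univ _) (by rwa [Finset.card_singleton])
    simp only [Finset.singleton_subset_iff, Finset.card_singleton] at h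
    rw [h k, h l]

/-- All sets of size `r` are used equally often, and the remainder is distributed greedily. -/
lemma exists_multiset_count_le (hr : r ≤ Fintype.card α) (n : ℕ) :
    ∃ m : Multiset (Finset α), m.card = n ∧ (∀ U ∈ m, #U = r) ∧
      (∀ k l, m.countP (k ∈ ·) ≤ m.countP (l ∈ ·) + 1) ∧
      ∀ U, m.count U ≤ n / (Fintype.card α).choose r + (Fintype.card α).choose r := by
  set C := (Fintype.card α).choose r
  have hC : 0 < C := Nat.choose_pos hr
  obtain ⟨g, hgcard, hg, hgbal⟩ := exists_multiset_countP_mem_le_add_one hr (n % C)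
  let P : Finset (Finset α) := Finset.univ.powersetCard r
  have hP (k l : α) : P.val.countP (k ∈ ·) = P.val.countP (l ∈ ·) := by
    rw [Multiset.countP_eq_card_filter, Multiset.countP_eq_card_filter]
    exact card_filter_mem_powersetCard_univ_eq k l
  refine ⟨(n / C) • P.val + g, ?_, fun U hU => ?_, fun k l => ?_, fun U => ?_⟩
  · rw [Multiset.card_add, Multiset.card_nsmul, hgcard, Finset.card_val, Finset.card_powersetCard,
      Finset.card_univ, mul_comm, Nat.div_add_mod]
  · rcases Multiset.mem_add.1 hU with hU | hU
    · exact (Finset.mem_powersetCard.1 (Multiset.mem_of_mem_nsmul hU)).2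
    · exact hg U hU
  · rw [Multiset.countP_add, Multiset.countP_add, Multiset.countP_nsmul, Multiset.countP_nsmul,
      hP k l, add_assoc]
    exact Nat.add_le_add_left (hgbal k l) _
  · rw [Multiset.count_add, Multiset.count_nsmul]
    have hPU : P.val.count U ≤ 1 := Multiset.nodup_iff_count_le_one.1 P.nodup U
    have hgU : g.count U ≤ C := (Multiset.count_le_card U g).trans
      (hgcard ▸ (Nat.mod_lt n hC).le)
    exact Nat.add_le_add (mul_le_of_le_one_right (Nat.zero_le _) hPU) hgU

lemma exists_fin_map_univ_eq {β : Type*} {n : ℕ} (m : Multiset β) (hm : m.card = n) :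
    ∃ f : Fin n → β, Finset.univ.val.map f = m := by
  subst hm
  refine ⟨fun i => m.toList.get (i.cast m.length_toList.symm), ?_⟩
  rw [Fin.univ_val_map, ← List.ofFn_congr m.length_toList (m.toList.get), List.ofFn_get,
    Multiset.coe_toList]

lemma exists_fin_fun_balanced (hr : r ≤ Fintype.card α) (n : ℕ) :
    ∃ f : Fin n → Finset α, (∀ j, #(f j) = r) ∧
      (∀ k l, #{j | k ∈ f j} ≤ #{j | l ∈ f j} + 1) ∧
      ∀ U, #{j | f j = U} ≤ n / (Fintype.card α).choose r + (Fintype.card α).choose r := by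
  obtain ⟨m, hcard, hm, hbal, hcount⟩ := exists_multiset_count_le (α := α) hr n
  obtain ⟨f, rfl⟩ := exists_fin_map_univ_eq m hcard
  simp only [Multiset.countP_map, Multiset.count_map, eq_comm (b := f _)] at hbal hcount
  exact ⟨f, by simpa using hm, hbal, hcount⟩

lemma sum_card_filter_mem {ι : Type*} [Fintype ι] {f : ι → Finset α} (hf : ∀ i, #(f i) = r) :
    ∑ k : α, #{i | k ∈ f i} = r * Fintype.card ι := by
  simp_rw [Finset.card_filter]
  rw [Finset.sum_comm]
  simp [hf, mul_comm]

end Balanced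

section Allocations

variable {n K r : ℕ}

lemma exists_allocation_card_batch_le (hr : 0 < r) (hrK : r ≤ K) (n : ℕ) :
    ∃ A : Allocation n K r, (∀ j, #(A.mappers j) = r) ∧
      ∀ S, #(A.batch S) ≤ n / K.choose r + K.choose r := by
  obtain ⟨f, hf, hfbal, hfcount⟩ := exists_fin_fun_balanced (α := Fin K) (r := r)
    (by rwa [Fintype.card_fin]) n
  obtain ⟨g, hg, hgbal, -⟩ := exists_fin_fun_balanced (α := Fin K) (r := 1)
    (by rw [Fintype.card_fin]; exact hr.trans_le hrK) n
  have hcover (j : Fin n) : ∃ k, k ∈ f j := Finset.card_pos.1 (by rw [hf j]; exact hr)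
  have hunique (i : Fin n) : ∃! k, k ∈ g i := by
    obtain ⟨k, hk⟩ := Finset.card_eq_one.1 (hg i)
    exact ⟨k, by simp [hk]⟩
  let A : Allocation n K r :=
    { map := fun k => {j | k ∈ f j}
      reduce := fun k => {i | k ∈ g i}
      map_cover := by simpa using hcover
      map_load := by simpa using sum_card_filter_mem hf
      map_equal := hfbal
      reduce_partition := by simpa using hunique
      reduce_equal := hgbal }
  have hA : A.mappers = f := by
    ext j k
    simp [A, Allocation.mappers]
  refine ⟨A, fun j => hA ▸ hf j, fun S => ?_⟩
  rw [Allocation.batch, hA]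
  simpa using hfcount S

lemma sum_card_reduce (A : Allocation n K r) : ∑ k, #(A.reduce k) = n := by
  have h (k : Fin K) : A.reduce k = ({i | A.reducer i = k} : Finset (Fin n)) := by
    ext i
    simp [A.mem_reduce_iff]
  simp_rw [h]
  rw [← Finset.card_eq_sum_card_fiberwise (fun i _ => Finset.mem_coe.2 (Finset.mem_univ _)),
    Finset.card_univ, Fintype.card_fin]

lemma card_reduce_le (A : Allocation n K r) (k : Fin K) : #(A.reduce k) ≤ n / K + 1 := by
  have h := Finset.EquitableOn.le_add_one (s := Finset.univ) (f := fun k => #(A.reduce k))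
    (fun k l _ _ => A.reduce_equal k l) (Finset.mem_univ k)
  rwa [sum_card_reduce, Finset.card_univ, Fintype.card_fin] at h

lemma abs_card_sub_sum_div_le_one {c : Fin K → ℕ} (hc : ∀ k l, c k ≤ c l + 1) (k : Fin K) :
    |(c k : ℝ) - (∑ l, c l : ℕ) / K| ≤ 1 := by
  have hequitable : (↑(Finset.univ : Finset (Fin K)) : Set (Fin K)).EquitableOn c :=
    fun k l _ _ => hc k l
  have hlower := Finset.EquitableOn.le hequitable (Finset.mem_univ k)
  have hupper := Finset.EquitableOn.le_add_one hequitable (Finset.mem_univ k)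
  rw [Finset.card_univ, Fintype.card_fin, ← Nat.floor_div_eq_div (K := ℝ)] at hlower hupper
  have hfloor := Nat.floor_le (a := ((∑ l, c l : ℕ) : ℝ) / K) (by positivity)
  have hfloor' := Nat.lt_floor_add_one (((∑ l, c l : ℕ) : ℝ) / K)
  rw [← Nat.cast_le (α := ℝ)] at hlower hupper
  rw [abs_le]
  push_cast at *
  constructor <;> linarith

lemma abs_sum_card_reduce_mul_card_map_compl_sub_le (A : Allocation n K r) :
    |∑ k, (#(A.reduce k) : ℝ) * #(A.map k)ᶜ - (1 - r / K) * n ^ 2| ≤ (n : ℝ) := by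
  have hmap (k : Fin K) : |(#(A.map k) : ℝ) - r * n / K| ≤ 1 := by
    simpa [A.map_load] using abs_card_sub_sum_div_le_one A.map_equal k
  have hreduce : ∑ k, (#(A.reduce k) : ℝ) = n := mod_cast sum_card_reduce A
  calc |∑ k, (#(A.reduce k) : ℝ) * #(A.map k)ᶜ - (1 - r / K) * n ^ 2|
      = |∑ k, (#(A.reduce k) : ℝ) * (r * n / K - #(A.map k))| := by
        have h (k : Fin K) : (#(A.reduce k) : ℝ) * (r * n / K - #(A.map k))
            = #(A.reduce k) * #(A.map k)ᶜ - #(A.reduce k) * (n - r * n / K) := by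
          rw [Finset.card_compl, Fintype.card_fin, Nat.cast_sub (card_finset_fin_le _)]
          ring
        rw [Finset.sum_congr rfl fun k _ => h k, Finset.sum_sub_distrib, ← Finset.sum_mul, hreduce]
        ring_nf
    _ ≤ ∑ k, (#(A.reduce k) : ℝ) * 1 := by
        refine (Finset.abs_sum_le_sum_abs _ _).trans (Finset.sum_le_sum fun k _ => ?_)
        rw [abs_mul, Nat.abs_cast, abs_sub_comm]
        exact mul_le_mul_of_nonneg_left (hmap k) (Nat.cast_nonneg _)
    _ = n := by rw [← Finset.sum_mul, hreduce, mul_one]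

end Allocations

section LawOfLargeNumbers

variable {ν : Measure ℝ}

/-- The mean absolute deviation from its mean of a sum of `k` independent variables with law `ν`. -/
noncomputable def meanDeviation (ν : Measure ℝ) (k : ℕ) : ℝ :=
  ∫ d : Fin k → ℝ, |∑ i, d i - k * ∫ x, x ∂ν| ∂Measure.pi fun _ => ν

lemma integral_abs_sum_sub_eq_meanDeviation {Ω ι : Type*} [MeasurableSpace Ω] {P : Measure Ω}
    [IsProbabilityMeasure P] {X : ι → Ω → ℝ} (hX : ∀ i, Measurable (X i))
    (hlaw : ∀ i, P.map (X i) = ν) (hindep : iIndepFun X P) (S : Finset ι) :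
    ∫ ω, |∑ i ∈ S, X i ω - #S * ∫ x, x ∂ν| ∂P = meanDeviation ν #S := by
  have hmap : P.map (fun ω (j : Fin #S) => X (S.equivFin.symm j) ω) = Measure.pi fun _ => ν := by
    have h := (iIndepFun_iff_map_fun_eq_pi_map fun j => (hX (S.equivFin.symm j)).aemeasurable).1
      (hindep.precomp (Subtype.val_injective.comp S.equivFin.symm.injective))
    simpa only [Function.comp_apply, hlaw] using h
  rw [meanDeviation, ← hmap, integral_map
    (measurable_pi_lambda _ fun j => hX _).aemeasurable (by fun_prop)]
  refine integral_congr_ae (.of_forall fun ω => ?_)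
  beta_reduce
  rw [S.equivFin.symm.sum_comp fun i => X i ω, Finset.sum_coe_sort S fun i => X i ω]

lemma tendsto_meanDeviation_div [IsProbabilityMeasure ν] (hν : Integrable id ν) :
    Tendsto (fun k : ℕ => meanDeviation ν k / k) atTop (𝓝 0) := by
  let P : Measure (ℕ → ℝ) := Measure.infinitePi fun _ => ν
  let X (i : ℕ) (ω : ℕ → ℝ) : ℝ := ω i
  have hX (i : ℕ) : Measurable (X i) := measurable_pi_apply i
  have hlaw (i : ℕ) : P.map (X i) = ν := (measurePreserving_eval_infinitePi (fun _ => ν) i).map_eq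
  have hindep : iIndepFun X P := iIndepFun_infinitePi (X := fun _ => id) (by fun_prop)
  have hident (i : ℕ) : IdentDistrib (X i) (X 0) P P :=
    ⟨(hX i).aemeasurable, (hX 0).aemeasurable, by rw [hlaw, hlaw]⟩
  have hint : Integrable (X 0) P := by
    rw [← hlaw 0] at hν
    exact hν.comp_measurable (hX 0)
  have hmean : ∫ ω, X 0 ω ∂P = ∫ x, x ∂ν := by
    rw [← hlaw 0, integral_map (hX 0).aemeasurable (by fun_prop)]
  have hlim := strong_law_Lp le_rfl ENNReal.one_ne_top X (memLp_one_iff_integrable.2 hint)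
    (fun i j hij => hindep.indepFun hij) hident
  refine ((ENNReal.tendsto_toReal ENNReal.zero_ne_top).comp hlim).congr' ?_
  filter_upwards [eventually_gt_atTop 0] with k hk
  have hk' : (0 : ℝ) < k := mod_cast hk
  rw [Function.comp_apply, eLpNorm_one_eq_lintegral_enorm, hmean,
    ← Finset.card_range k, ← integral_abs_sum_sub_eq_meanDeviation hX hlaw hindep,
    Finset.card_range, ← integral_norm_eq_lintegral_enorm (by fun_prop), ← integral_div]
  refine integral_congr_ae (.of_forall fun ω => ?_)
  beta_reduce
  rw [smul_eq_mul, Real.norm_eq_abs, ← abs_of_pos hk', ← abs_div, abs_of_pos hk', sub_div,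
    mul_div_cancel_left₀ _ hk'.ne', inv_mul_eq_div]

lemma tendsto_comp_div_of_le {u : ℕ → ℝ} (hu : Tendsto (fun k : ℕ => u k / k) atTop (𝓝 0))
    {κ : ℕ → ℕ} (hκ : ∀ n, κ n ≤ n) : Tendsto (fun n : ℕ => u (κ n) / n) atTop (𝓝 0) := by
  rw [Metric.tendsto_atTop] at hu ⊢
  intro ε hε
  obtain ⟨N, hN⟩ := hu (ε / 2) (half_pos hε)
  have hbound (k : ℕ) : |u k| ≤ ε / 2 * k + ∑ i ∈ Finset.range (N + 1), |u i| := by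
    rcases lt_or_ge k (N + 1) with hk | hk
    · exact le_add_of_nonneg_of_le (by positivity) (Finset.single_le_sum
        (f := fun i => |u i|) (fun i _ => abs_nonneg _) (Finset.mem_range.2 hk))
    · have h := (hN k (Nat.le_of_succ_le hk)).le
      have hk' : (0 : ℝ) < k := mod_cast (Nat.succ_pos N).trans_le hk
      rw [dist_zero_right, Real.norm_eq_abs, abs_div, Nat.abs_cast, div_le_iff₀ hk'] at h
      exact h.trans (le_add_of_nonneg_right (by positivity))
  obtain ⟨M, hM⟩ := exists_nat_gt ((∑ i ∈ Finset.range (N + 1), |u i|) / (ε / 2))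
  refine ⟨M + 1, fun n hn => ?_⟩
  have hn' : (0 : ℝ) < n := mod_cast (Nat.succ_pos M).trans_le hn
  rw [dist_zero_right, Real.norm_eq_abs, abs_div, Nat.abs_cast, div_lt_iff₀ hn']
  rw [div_lt_iff₀ (half_pos hε)] at hM
  calc |u (κ n)| ≤ ε / 2 * κ n + ∑ i ∈ Finset.range (N + 1), |u i| := hbound _
    _ < ε / 2 * n + M * (ε / 2) := by
      have hκn : ε / 2 * κ n ≤ ε / 2 * n := by gcongr; exact hκ n
      linarith
    _ ≤ ε * n := by nlinarith [(mod_cast (Nat.le_of_succ_le hn) : (M : ℝ) ≤ n)]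

end LawOfLargeNumbers

section ConditionalEdgeCount

lemma integral_abs_sub_integral_le {Ω : Type*} [MeasurableSpace Ω] {P : Measure Ω}
    [IsProbabilityMeasure P] {X : Ω → ℝ} (hX : MemLp X 2 P) {a : ℝ} (ha : 0 < a) :
    ∫ ω, |X ω - ∫ ω', X ω' ∂P| ∂P ≤ Var[X; P] / (2 * a) + a / 2 := by
  have hXm : MemLp (fun ω => X ω - ∫ ω', X ω' ∂P) 2 P := hX.sub (memLp_const _)
  have hsq : Integrable (fun ω => (X ω - ∫ ω', X ω' ∂P) ^ 2 / (2 * a)) P :=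
    hXm.integrable_sq.div_const _
  have hamgm (y : ℝ) : |y| ≤ y ^ 2 / (2 * a) + a / 2 := by
    rw [div_add_div _ _ (by positivity) two_ne_zero, le_div_iff₀ (by positivity), ← sq_abs]
    nlinarith [sq_nonneg (|y| - a)]
  calc ∫ ω, |X ω - ∫ ω', X ω' ∂P| ∂P
      ≤ ∫ ω, ((X ω - ∫ ω', X ω' ∂P) ^ 2 / (2 * a) + a / 2) ∂P :=
        integral_mono (hXm.integrable one_le_two).abs (hsq.add (integrable_const _))
          fun ω => hamgm _
    _ = Var[X; P] / (2 * a) + a / 2 := by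
        rw [integral_add hsq (integrable_const _), integral_div, integral_const, probReal_univ,
          one_smul, variance_eq_integral hX.aemeasurable]

variable {n : ℕ} {d : Fin n → ℝ}

lemma integral_edge (d : Fin n → ℝ) (e : Sym2 (Fin n)) :
    ∫ G, (if G e = true then (1 : ℝ) else 0) ∂edgeLaw d = edgeProb d e := by
  have h := integral_comp_eval (μ := fun e => bernoulliMeasure true false (edgeProb d e)) (i := e)
    (f := fun b : Bool => if b = true then (1 : ℝ) else 0)
    Measurable.of_discrete.aestronglyMeasurable
  rw [edgeLaw, h, integral_bernoulliMeasure]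
  simp

lemma card_edgesBetween_eq_sum (G : LoopGraph n) (R B : Finset (Fin n)) :
    (#(edgesBetween G R B) : ℝ) = ∑ p ∈ R ×ˢ B, if G s(p.1, p.2) = true then 1 else 0 := by
  rw [edgesBetween, Finset.sum_boole]

lemma integral_card_edgesBetween (d : Fin n → ℝ) (R B : Finset (Fin n)) :
    ∫ G, (#(edgesBetween G R B) : ℝ) ∂edgeLaw d = ∑ p ∈ R ×ˢ B, (edgeProb d s(p.1, p.2) : ℝ) := by
  simp_rw [card_edgesBetween_eq_sum]
  rw [integral_finsetSum _ fun _ _ => Integrable.of_finite]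
  exact Finset.sum_congr rfl fun p _ => integral_edge d _

lemma card_filter_sym2_mk_eq_le_two (P : Finset (Fin n × Fin n)) (e : Sym2 (Fin n)) :
    #{p ∈ P | s(p.1, p.2) = e} ≤ 2 := by
  induction e with
  | h i j =>
    refine (Finset.card_le_card (t := {(i, j), (j, i)}) fun p hp => ?_).trans Finset.card_le_two
    have h := (Finset.mem_filter.1 hp).2
    rw [Sym2.eq_iff] at h
    simpa only [Finset.mem_insert, Finset.mem_singleton, Prod.ext_iff] using h

lemma sum_sym2_mk_eq_sum_card_mul (P : Finset (Fin n × Fin n)) (g : Sym2 (Fin n) → ℝ) :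
    ∑ p ∈ P, g s(p.1, p.2) = ∑ e, #{p ∈ P | s(p.1, p.2) = e} * g e := by
  rw [← Finset.sum_fiberwise P fun p => s(p.1, p.2)]
  refine Finset.sum_congr rfl fun e _ => ?_
  rw [Finset.sum_congr rfl fun p hp => by rw [(Finset.mem_filter.1 hp).2], Finset.sum_const,
    nsmul_eq_mul]

-- An edge with both ends in `R ∩ B` is counted twice, so the indicators of the ordered pairs are
-- not independent: they are first grouped by unordered pair.
lemma variance_card_edgesBetween_le (d : Fin n → ℝ) (R B : Finset (Fin n)) :
    Var[fun G => (#(edgesBetween G R B) : ℝ); edgeLaw d]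
      ≤ 2 * ∑ p ∈ R ×ˢ B, (edgeProb d s(p.1, p.2) : ℝ) := by
  let c (e : Sym2 (Fin n)) : ℝ := #{p ∈ R ×ˢ B | s(p.1, p.2) = e}
  let X (e : Sym2 (Fin n)) (b : Bool) : ℝ := c e * if b = true then 1 else 0
  have hX (e : Sym2 (Fin n)) : MemLp (X e) 2 (bernoulliMeasure true false (edgeProb d e)) :=
    MemLp.of_discrete
  have hsum : (fun G : LoopGraph n => (#(edgesBetween G R B) : ℝ)) =
      ∑ e, fun G : LoopGraph n => X e (G e) := by
    funext G
    rw [card_edgesBetween_eq_sum,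
      sum_sym2_mk_eq_sum_card_mul _ fun e => if G e = true then 1 else 0, Finset.sum_apply]
  rw [hsum, edgeLaw, variance_sum_pi hX, sum_sym2_mk_eq_sum_card_mul _ fun e => (edgeProb d e : ℝ),
    Finset.mul_sum]
  refine Finset.sum_le_sum fun e _ => ?_
  have hc : c e ≤ 2 := Nat.cast_le_ofNat.2 (card_filter_sym2_mk_eq_le_two _ e)
  calc Var[X e; bernoulliMeasure true false (edgeProb d e)]
      ≤ ∫ b, (X e ^ 2) b ∂bernoulliMeasure true false (edgeProb d e) :=
        variance_le_expectation_sq (hX e).aestronglyMeasurable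
    _ = c e * (c e * edgeProb d e) := by
        rw [integral_bernoulliMeasure]
        simp only [X, Pi.pow_apply, if_true, Bool.false_eq_true, if_false, smul_eq_mul]
        ring
    _ ≤ 2 * (c e * edgeProb d e) :=
        mul_le_mul_of_nonneg_right hc (mul_nonneg (Nat.cast_nonneg _) (edgeProb d e).2.1)

lemma rho_nonneg (hd : ∀ i, 0 ≤ d i) : 0 ≤ rho d :=
  inv_nonneg.2 (Finset.sum_nonneg fun i _ => hd i)

lemma rho_mul_sum_le_one (hd : ∀ i, 0 ≤ d i) (S : Finset (Fin n)) :
    rho d * ∑ i ∈ S, d i ≤ 1 := by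
  rw [rho, inv_mul_eq_div]
  exact div_le_one_of_le₀ (Finset.sum_le_univ_sum_of_nonneg hd) (Finset.sum_nonneg fun i _ => hd i)

lemma sum_mul_rho_mul_sum (hd : ∀ i, 0 ≤ d i) (S : Finset (Fin n)) :
    (∑ i, d i) * (rho d * ∑ i ∈ S, d i) = ∑ i ∈ S, d i := by
  have hS : ∑ i ∈ S, d i ≤ ∑ i, d i := Finset.sum_le_univ_sum_of_nonneg hd
  rcases eq_or_ne (∑ i, d i) 0 with h | h
  · rw [h, zero_mul]
    exact le_antisymm (Finset.sum_nonneg fun i _ => hd i) (h ▸ hS)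
  · rw [rho, mul_inv_cancel_left₀ h]

lemma rho_mul_sum_mul_sum_le (hd : ∀ i, 0 ≤ d i) (R B : Finset (Fin n)) :
    rho d * (∑ i ∈ R, d i) * ∑ j ∈ B, d j ≤ ∑ i, d i :=
  (mul_le_of_le_one_left (Finset.sum_nonneg fun i _ => hd i) (rho_mul_sum_le_one hd R)).trans
    (Finset.sum_le_univ_sum_of_nonneg hd)

lemma abs_rho_mul_sum_mul_sum_sub_le (hn : 0 < n) (hd : ∀ i, 0 ≤ d i) (m : ℝ)
    (R B : Finset (Fin n)) :
    |rho d * (∑ i ∈ R, d i) * (∑ j ∈ B, d j) - #R * #B * m / n|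
      ≤ |∑ i ∈ R, d i - #R * m| + |∑ j ∈ B, d j - #B * m| + |∑ i, d i - n * m| := by
  have hn' : (0 : ℝ) < n := mod_cast hn
  set x := rho d * ∑ j ∈ B, d j with hx
  have hx0 : 0 ≤ x := mul_nonneg (rho_nonneg hd) (Finset.sum_nonneg fun i _ => hd i)
  have hx1 : x ≤ 1 := rho_mul_sum_le_one hd B
  have hDx : (∑ i, d i) * x = ∑ j ∈ B, d j := sum_mul_rho_mul_sum hd B
  have hR : (#R : ℝ) / n ≤ 1 :=
    div_le_one_of_le₀ (mod_cast card_finset_fin_le R) hn'.le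
  have hsplit : rho d * (∑ i ∈ R, d i) * (∑ j ∈ B, d j) - #R * #B * m / n =
      (∑ i ∈ R, d i - #R * m) * x +
        #R / n * (∑ j ∈ B, d j - #B * m - (∑ i, d i - n * m) * x) := by
    rw [mul_right_comm, ← hx, ← sub_eq_zero]
    field_simp
    linear_combination #R * hDx
  have hmul (y : ℝ) : |y * x| ≤ |y| := by
    rw [abs_mul, abs_of_nonneg hx0]
    exact mul_le_of_le_one_right (abs_nonneg y) hx1
  calc _ ≤ |(∑ i ∈ R, d i - #R * m) * x| +
        |#R / n * (∑ j ∈ B, d j - #B * m - (∑ i, d i - n * m) * x)| := by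
        rw [hsplit]; exact abs_add_le _ _
    _ ≤ |∑ i ∈ R, d i - #R * m| + |∑ j ∈ B, d j - #B * m - (∑ i, d i - n * m) * x| := by
        rw [abs_mul (#R / n : ℝ), abs_of_nonneg (by positivity : (0 : ℝ) ≤ #R / n)]
        exact add_le_add (hmul _) (mul_le_of_le_one_left (abs_nonneg _) hR)
    _ ≤ |∑ i ∈ R, d i - #R * m| + (|∑ j ∈ B, d j - #B * m| + |∑ i, d i - n * m|) := by
        gcongr
        exact (abs_sub _ _).trans (add_le_add_right (hmul _) _)
    _ = _ := (add_assoc _ _ _).symm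

lemma edgeProb_le (hd : ∀ i, 0 ≤ d i) (i j : Fin n) :
    (edgeProb d s(i, j) : ℝ) ≤ rho d * (d i * d j) := by
  rw [edgeProb, Set.coe_projIcc]
  exact max_le (mul_nonneg (rho_nonneg hd) (mul_nonneg (hd i) (hd j))) (min_le_right _ _)

lemma le_edgeProb {x : ℝ} (hx : x ≤ 1) {i j : Fin n} (h : x ≤ rho d * (d i * d j)) :
    x ≤ edgeProb d s(i, j) := by
  rw [edgeProb, Set.coe_projIcc]
  exact le_max_of_le_right (le_min hx h)

lemma sum_product_mul_mul (f : Fin n → ℝ) (c : ℝ) (R B : Finset (Fin n)) :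
    ∑ p ∈ R ×ˢ B, c * (f p.1 * f p.2) = c * (∑ i ∈ R, f i) * ∑ j ∈ B, f j := by
  rw [← Finset.mul_sum, Finset.sum_product, ← Finset.sum_mul_sum, mul_assoc]

lemma sum_edgeProb_le (hd : ∀ i, 0 ≤ d i) (R B : Finset (Fin n)) :
    ∑ p ∈ R ×ˢ B, (edgeProb d s(p.1, p.2) : ℝ) ≤ rho d * (∑ i ∈ R, d i) * ∑ j ∈ B, d j := by
  rw [← sum_product_mul_mul]
  exact Finset.sum_le_sum fun p _ => edgeProb_le hd p.1 p.2

lemma rho_mul_sum_mul_sum_sub_sum_edgeProb_le_of_rho_mul_sq_le_one (hd : ∀ i, 0 ≤ d i) {M : ℝ}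
    (hM : 0 ≤ M) (hρM : rho d * M ^ 2 ≤ 1) (R B : Finset (Fin n)) :
    rho d * (∑ i ∈ R, d i) * (∑ j ∈ B, d j) - ∑ p ∈ R ×ˢ B, (edgeProb d s(p.1, p.2) : ℝ)
      ≤ 2 * ∑ i, (d i - min (d i) M) := by
  have hρ := rho_nonneg hd
  have hmin (i : Fin n) : 0 ≤ min (d i) M := le_min (hd i) hM
  have hexc (i : Fin n) : 0 ≤ d i - min (d i) M := sub_nonneg.2 (min_le_left _ _)
  have hp : rho d * (∑ i ∈ R, min (d i) M) * ∑ j ∈ B, min (d j) M ≤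
      ∑ p ∈ R ×ˢ B, (edgeProb d s(p.1, p.2) : ℝ) := by
    rw [← sum_product_mul_mul]
    refine Finset.sum_le_sum fun p _ => le_edgeProb (hρM.trans' ?_)
      (mul_le_mul_of_nonneg_left ?_ hρ)
    · rw [sq]
      exact mul_le_mul_of_nonneg_left
        (mul_le_mul (min_le_right _ _) (min_le_right _ _) (hmin _) hM) hρ
    · exact mul_le_mul (min_le_left _ _) (min_le_left _ _) (hmin _) (hd _)
  have hscale (S : Finset (Fin n)) {x : ℝ} (hx : x ≤ 1) :
      x * (∑ i ∈ S, d i - ∑ i ∈ S, min (d i) M) ≤ ∑ i, (d i - min (d i) M) := by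
    rw [← Finset.sum_sub_distrib]
    exact (mul_le_of_le_one_left (Finset.sum_nonneg fun i _ => hexc i) hx).trans
      (Finset.sum_le_univ_sum_of_nonneg hexc)
  have hR := hscale R (rho_mul_sum_le_one hd B)
  have hB := hscale B (x := rho d * ∑ i ∈ R, min (d i) M) <|
    (mul_le_mul_of_nonneg_left (Finset.sum_le_sum fun i _ => min_le_left _ _) hρ).trans
      (rho_mul_sum_le_one hd R)
  linarith

-- When `ρ M² > 1`, the total degree, which bounds the left-hand side, is less than `M²`.
lemma rho_mul_sum_mul_sum_sub_sum_edgeProb_le (hd : ∀ i, 0 ≤ d i) {M : ℝ} (hM : 0 ≤ M)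
    (R B : Finset (Fin n)) :
    rho d * (∑ i ∈ R, d i) * (∑ j ∈ B, d j) - ∑ p ∈ R ×ˢ B, (edgeProb d s(p.1, p.2) : ℝ)
      ≤ 2 * ∑ i, (d i - min (d i) M) + M ^ 2 := by
  rcases le_or_gt (rho d * M ^ 2) 1 with hρM | hρM
  · exact (rho_mul_sum_mul_sum_sub_sum_edgeProb_le_of_rho_mul_sq_le_one hd hM hρM R B).trans
      (le_add_of_nonneg_right (sq_nonneg M))
  · have hρ : 0 < rho d := pos_of_mul_pos_left (one_pos.trans hρM) (sq_nonneg M)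
    have hD : ∑ i, d i < M ^ 2 := by
      rwa [rho, inv_mul_eq_div, one_lt_div (inv_pos.1 hρ)] at hρM
    have hp : 0 ≤ ∑ p ∈ R ×ˢ B, (edgeProb d s(p.1, p.2) : ℝ) :=
      Finset.sum_nonneg fun p _ => (edgeProb d _).2.1
    have hexc : 0 ≤ ∑ i, (d i - min (d i) M) :=
      Finset.sum_nonneg fun i _ => sub_nonneg.2 (min_le_left _ _)
    linarith [rho_mul_sum_mul_sum_le hd R B]

lemma integral_abs_card_edgesBetween_sub_le (hn : 0 < n) (hd : ∀ i, 0 ≤ d i) (m : ℝ) {a M : ℝ}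
    (ha : 0 < a) (hM : 0 ≤ M) (R B : Finset (Fin n)) :
    ∫ G, |#(edgesBetween G R B) - #R * #B * m / n| ∂edgeLaw d
      ≤ |∑ i ∈ R, d i - #R * m| + |∑ j ∈ B, d j - #B * m| + |∑ i, d i - n * m| +
        ((∑ i, d i) / a + a / 2 + (2 * ∑ i, (d i - min (d i) M) + M ^ 2)) := by
  set p := ∑ p ∈ R ×ˢ B, (edgeProb d s(p.1, p.2) : ℝ)
  set q := rho d * (∑ i ∈ R, d i) * ∑ j ∈ B, d j
  have hpq : p ≤ q := sum_edgeProb_le hd R B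
  have hvar : ∫ G, |#(edgesBetween G R B) - p| ∂edgeLaw d ≤ (∑ i, d i) / a + a / 2 := by
    have h := integral_abs_sub_integral_le (P := edgeLaw d)
      (X := fun G => (#(edgesBetween G R B) : ℝ)) MemLp.of_discrete ha
    rw [integral_card_edgesBetween] at h
    refine h.trans ?_
    rw [← mul_div_mul_left _ a two_ne_zero]
    gcongr
    exact (variance_card_edgesBetween_le d R B).trans
      (by gcongr; exact hpq.trans (rho_mul_sum_mul_sum_le hd R B))
  have hbias : |p - #R * #B * m / n| ≤ |q - #R * #B * m / n| + (q - p) := by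
    rw [← abs_of_nonneg (sub_nonneg.2 hpq), abs_sub_comm q p, add_comm]
    exact abs_sub_le _ _ _
  have htri : ∫ G, |#(edgesBetween G R B) - #R * #B * m / n| ∂edgeLaw d ≤
      ∫ G, |#(edgesBetween G R B) - p| ∂edgeLaw d + |p - #R * #B * m / n| := by
    calc _ ≤ ∫ G, (|#(edgesBetween G R B) - p| + |p - #R * #B * m / n|) ∂edgeLaw d :=
          integral_mono .of_finite .of_finite fun G => abs_sub_le _ _ _
      _ = _ := by
          rw [integral_add .of_finite .of_finite, integral_const, probReal_univ, one_smul]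
  linarith [abs_rho_mul_sum_mul_sum_sub_le hn hd m R B,
    rho_mul_sum_mul_sum_sub_sum_edgeProb_le hd hM R B]

end ConditionalEdgeCount

section EdgeCount

variable {ν : Measure ℝ}

/-- The random graph on `n` vertices in which the expected degrees are independent with law `ν`;
`powerLawGraph n γ` is the case of the Pareto distribution. -/
noncomputable def iidDegreeGraph (n : ℕ) (ν : Measure ℝ) : Measure (LoopGraph n) :=
  (Measure.pi fun _ => ν).bind edgeLaw

instance [IsProbabilityMeasure ν] {n : ℕ} : IsProbabilityMeasure (iidDegreeGraph n ν) := by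
  refine ⟨?_⟩
  rw [iidDegreeGraph, Measure.bind_apply .univ measurable_edgeLaw.aemeasurable]
  simp only [measure_univ, lintegral_one]

lemma integral_iidDegreeGraph [IsProbabilityMeasure ν] {n : ℕ} (f : LoopGraph n → ℝ) :
    ∫ G, f G ∂iidDegreeGraph n ν =
      ∫ d : Fin n → ℝ, ∫ G, f G ∂edgeLaw d ∂Measure.pi fun _ => ν :=
  Kernel.integral_comp (η := ⟨edgeLaw, measurable_edgeLaw⟩)
    (κ := Kernel.const Unit (Measure.pi fun _ : Fin n => ν)) (a := ())
    (Integrable.of_finite (μ := iidDegreeGraph n ν))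

lemma integral_sum_comp_eval [IsProbabilityMeasure ν] {n : ℕ} {f : ℝ → ℝ} (hf : Integrable f ν) :
    ∫ d : Fin n → ℝ, ∑ i, f (d i) ∂(Measure.pi fun _ => ν) = n * ∫ x, f x ∂ν := by
  rw [integral_finsetSum _ fun i _ => integrable_comp_eval (μ := fun _ => ν) hf,
    Finset.sum_congr rfl fun i _ =>
      integral_comp_eval (μ := fun _ => ν) hf.aestronglyMeasurable]
  simp only [Finset.sum_const, Finset.card_univ, Fintype.card_fin, nsmul_eq_mul]

lemma integral_pi_abs_sum_sub_eq_meanDeviation [IsProbabilityMeasure ν] {n : ℕ}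
    (S : Finset (Fin n)) :
    ∫ d : Fin n → ℝ, |∑ i ∈ S, d i - #S * ∫ x, x ∂ν| ∂(Measure.pi fun _ => ν) =
      meanDeviation ν #S :=
  integral_abs_sum_sub_eq_meanDeviation (fun i => measurable_pi_apply i)
    (fun i => (measurePreserving_eval (fun _ => ν) i).map_eq)
    (iIndepFun_pi (X := fun _ => id) fun _ => aemeasurable_id) S

lemma integral_abs_card_edgesBetween_sub_iidDegreeGraph_le [IsProbabilityMeasure ν]
    (hν : Integrable id ν) (h0 : ∀ᵐ x ∂ν, 0 ≤ x) {n : ℕ} (hn : 0 < n) {a M : ℝ} (ha : 0 < a)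
    (hM : 0 ≤ M) (R B : Finset (Fin n)) :
    ∫ G, |#(edgesBetween G R B) - #R * #B * (∫ x, x ∂ν) / n| ∂iidDegreeGraph n ν
      ≤ meanDeviation ν #R + meanDeviation ν #B + meanDeviation ν n +
        (n * (∫ x, x ∂ν) / a + a / 2 + (2 * (n * ∫ x, (x - min x M) ∂ν) + M ^ 2)) := by
  set m := ∫ x, x ∂ν
  have hexc : Integrable (fun x => x - min x M) ν := hν.sub (hν.inf (integrable_const M))
  have hsum {f : ℝ → ℝ} (hf : Integrable f ν) (S : Finset (Fin n)) :
      Integrable (fun d : Fin n → ℝ => ∑ i ∈ S, f (d i)) (Measure.pi fun _ => ν) :=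
    integrable_finsetSum _ fun i _ => integrable_comp_eval (μ := fun _ => ν) hf
  have hD : Integrable (fun d : Fin n → ℝ => ∑ i, d i) (Measure.pi fun _ => ν) := hsum hν _
  have hdev (S : Finset (Fin n)) :
      Integrable (fun d : Fin n → ℝ => |∑ i ∈ S, d i - #S * m|) (Measure.pi fun _ => ν) :=
    ((hsum hν S).sub (integrable_const _)).abs
  have hdevD : Integrable (fun d : Fin n → ℝ => |∑ i, d i - n * m|) (Measure.pi fun _ => ν) :=
    (hD.sub (integrable_const _)).abs
  have hdev₃ := ((hdev R).fun_add (hdev B)).fun_add hdevD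
  have hvar := (hD.div_const a).fun_add (integrable_const (a / 2))
  have hbias := ((hsum hexc Finset.univ).const_mul 2).fun_add (integrable_const (M ^ 2))
  have hdegree : ∀ᵐ d : Fin n → ℝ ∂Measure.pi fun _ => ν, ∀ i, 0 ≤ d i :=
    ae_all_iff.2 fun i => (Measure.quasiMeasurePreserving_eval (fun _ => ν) i).ae h0
  rw [integral_iidDegreeGraph]
  refine (integral_mono_of_nonneg (.of_forall fun d => by positivity)
    (hdev₃.fun_add (hvar.fun_add hbias)) (hdegree.mono fun d hd =>
      integral_abs_card_edgesBetween_sub_le hn hd m ha hM R B)).trans_eq ?_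
  have hdevD_eq : ∫ d : Fin n → ℝ, |∑ i, d i - n * m| ∂(Measure.pi fun _ => ν) =
      meanDeviation ν n := rfl
  have hD_eq : ∫ d : Fin n → ℝ, ∑ i, d i ∂(Measure.pi fun _ => ν) = n * m :=
    integral_sum_comp_eval hν
  rw [integral_add hdev₃ (hvar.fun_add hbias), integral_add hvar hbias,
    integral_add ((hdev R).fun_add (hdev B)) hdevD, integral_add (hdev R) (hdev B),
    integral_add (hD.div_const a) (integrable_const _),
    integral_add ((hsum hexc _).const_mul 2) (integrable_const _), integral_div,
    integral_const_mul, integral_const, integral_const, probReal_univ, one_smul, one_smul,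
    integral_sum_comp_eval hexc, hD_eq, hdevD_eq, integral_pi_abs_sum_sub_eq_meanDeviation,
    integral_pi_abs_sum_sub_eq_meanDeviation]

lemma tendsto_integral_sub_min (hν : Integrable id ν) :
    Tendsto (fun M : ℝ => ∫ x, (x - min x M) ∂ν) atTop (𝓝 0) := by
  rw [← integral_zero ℝ ℝ (μ := ν)]
  refine tendsto_integral_filter_of_dominated_convergence (fun x => |x|)
    (.of_forall fun M => by fun_prop) ?_ hν.abs (.of_forall fun x => ?_)
  · filter_upwards [eventually_ge_atTop 0] with M hM
    refine .of_forall fun x => ?_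
    rw [Real.norm_eq_abs, abs_of_nonneg (sub_nonneg.2 (min_le_left _ _))]
    rcases min_cases x M with ⟨h, _⟩ | ⟨h, _⟩ <;> rw [h]
    · rw [sub_self]; exact abs_nonneg x
    · exact (sub_le_self x hM).trans (le_abs_self x)
  · refine tendsto_const_nhds.congr' ?_
    filter_upwards [eventually_ge_atTop x] with M hM
    rw [min_eq_left hM, sub_self]

theorem tendsto_integral_abs_card_edgesBetween_sub_div [IsProbabilityMeasure ν]
    (hν : Integrable id ν) (h0 : ∀ᵐ x ∂ν, 0 ≤ x) (R B : (n : ℕ) → Finset (Fin n)) :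
    Tendsto (fun n : ℕ => (∫ G, |#(edgesBetween G (R n) (B n)) -
      #(R n) * #(B n) * (∫ x, x ∂ν) / n| ∂iidDegreeGraph n ν) / n) atTop (𝓝 0) := by
  set m := ∫ x, x ∂ν with hm
  have hsqrt : Tendsto (fun n : ℕ => √(n : ℝ)) atTop atTop :=
    Real.tendsto_sqrt_atTop.comp tendsto_natCast_atTop_atTop
  have hdev := tendsto_meanDeviation_div hν
  have htail := (tendsto_integral_sub_min hν).comp (Real.tendsto_sqrt_atTop.comp hsqrt)
  have hbound : Tendsto (fun n : ℕ => meanDeviation ν #(R n) / n + meanDeviation ν #(B n) / n +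
      meanDeviation ν n / n + (m / √n + 1 / √n / 2 +
        (2 * ∫ x, (x - min x √√n) ∂ν + 1 / √n))) atTop (𝓝 0) := by
    have h1 : Tendsto (fun n : ℕ => 1 / √(n : ℝ)) atTop (𝓝 0) := hsqrt.const_div_atTop 1
    simpa using (((tendsto_comp_div_of_le hdev fun n => card_finset_fin_le (R n)).add
      (tendsto_comp_div_of_le hdev fun n => card_finset_fin_le (B n))).add hdev).add
      (((hsqrt.const_div_atTop m).add (h1.div_const 2)).add ((htail.const_mul 2).add h1))
  refine squeeze_zero' (.of_forall fun n => by positivity) ?_ hbound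
  filter_upwards [eventually_gt_atTop 0] with n hn
  have hn' : (0 : ℝ) < n := mod_cast hn
  have hs : √(n : ℝ) ^ 2 = n := Real.sq_sqrt hn'.le
  have hs0 : 0 < √(n : ℝ) := Real.sqrt_pos.2 hn'
  rw [div_le_iff₀ hn']
  refine (integral_abs_card_edgesBetween_sub_iidDegreeGraph_le hν h0 hn hs0
    (Real.sqrt_nonneg √n) _ _).trans (le_of_eq ?_)
  rw [Real.sq_sqrt hs0.le, ← hm]
  generalize √(n : ℝ) = s at hs hs0
  rw [← hs]
  field_simp

end EdgeCount

section UncodedLoad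

variable {n K r T : ℕ} {ν : Measure ℝ}

lemma ncard_neededIdx (G : LoopGraph n) (A : Allocation n K r) (k : Fin K) :
    (NeededIdx G A k).ncard = #(edgesBetween G (A.reduce k) (A.map k)ᶜ) := by
  rw [← Set.ncard_coe_finset]
  congr 1
  ext p
  simp [NeededIdx, edgesBetween, ValueIdx, LoopGraph.Adj, and_comm]

lemma uncodedLoad_eq_ofReal (hn : 0 < n) (hT : 0 < T) (A : Allocation n K r) (G : LoopGraph n) :
    uncodedLoad T A G =
      ENNReal.ofReal ((∑ k, (#(edgesBetween G (A.reduce k) (A.map k)ᶜ) : ℝ)) / n ^ 2) := by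
  rw [uncodedLoad, normalizedLoad_eq_ofReal hn hT, ← Finset.sum_mul]
  simp only [ncard_neededIdx]
  push_cast
  rw [mul_div_mul_right _ _ (mod_cast hT.ne')]

lemma tendsto_sum_card_reduce_mul_card_map_compl_div (A : ∀ n, Allocation n K r) :
    Tendsto (fun n : ℕ => (∑ k, (#((A n).reduce k) : ℝ) * #((A n).map k)ᶜ) / n ^ 2) atTop
      (𝓝 (1 - r / K)) := by
  rw [tendsto_iff_norm_sub_tendsto_zero]
  refine squeeze_zero' (.of_forall fun n => norm_nonneg _) ?_
    (tendsto_const_div_atTop_nhds_zero_nat 1)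
  filter_upwards [eventually_gt_atTop 0] with n hn
  have hn' : (0 : ℝ) < n := mod_cast hn
  have hn2 : (0 : ℝ) < n ^ 2 := by positivity
  have h := abs_sum_card_reduce_mul_card_map_compl_sub_le (A n)
  rw [Real.norm_eq_abs, div_sub' hn2.ne', abs_div, abs_of_pos hn2,
    div_le_div_iff₀ (by positivity) hn', mul_comm ((n : ℝ) ^ 2)]
  nlinarith

lemma tendsto_integral_card_edgesBetween_sub_div [IsProbabilityMeasure ν] (hν : Integrable id ν)
    (h0 : ∀ᵐ x ∂ν, 0 ≤ x) (R B : (n : ℕ) → Finset (Fin n)) :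
    Tendsto (fun n : ℕ => (∫ G, (#(edgesBetween G (R n) (B n)) : ℝ) ∂iidDegreeGraph n ν) / n -
      #(R n) * #(B n) / (n : ℝ) ^ 2 * ∫ x, x ∂ν) atTop (𝓝 0) := by
  refine squeeze_zero_norm (fun n => ?_) (tendsto_integral_abs_card_edgesBetween_sub_div hν h0 R B)
  set m := ∫ x, x ∂ν
  have h : (∫ G, (#(edgesBetween G (R n) (B n)) : ℝ) ∂iidDegreeGraph n ν) / n -
      #(R n) * #(B n) / (n : ℝ) ^ 2 * m =
      (∫ G, (#(edgesBetween G (R n) (B n)) - #(R n) * #(B n) * m / n) ∂iidDegreeGraph n ν) / n := by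
    rw [integral_sub .of_finite .of_finite, integral_const, probReal_univ, one_smul, sub_div]
    ring
  rw [h, Real.norm_eq_abs, abs_div, Nat.abs_cast]
  gcongr
  exact abs_integral_le_integral_abs

lemma mul_lintegral_uncodedLoad (hn : 0 < n) (hT : 0 < T) (A : Allocation n K r)
    (μ : Measure (LoopGraph n)) [IsFiniteMeasure μ] :
    n * ∫⁻ G, uncodedLoad T A G ∂μ = ENNReal.ofReal
      (∑ k, (∫ G, (#(edgesBetween G (A.reduce k) (A.map k)ᶜ) : ℝ) ∂μ) / n) := by
  simp_rw [uncodedLoad_eq_ofReal hn hT]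
  rw [← ofReal_integral_eq_lintegral_ofReal .of_finite (.of_forall fun G => by positivity),
    ← ENNReal.ofReal_natCast, ← ENNReal.ofReal_mul (by positivity), integral_div,
    integral_finsetSum _ fun _ _ => .of_finite, ← Finset.sum_div]
  field_simp

theorem tendsto_mul_lintegral_uncodedLoad [IsProbabilityMeasure ν] (hT : 0 < T)
    (hν : Integrable id ν) (h0 : ∀ᵐ x ∂ν, 0 ≤ x) (A : ∀ n, Allocation n K r) :
    Tendsto (fun n : ℕ => (n : ℝ≥0∞) * ∫⁻ G, uncodedLoad T (A n) G ∂iidDegreeGraph n ν) atTop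
      (𝓝 (ENNReal.ofReal ((1 - r / K) * ∫ x, x ∂ν))) := by
  have hdev := tendsto_finsetSum Finset.univ fun k (_ : k ∈ Finset.univ) =>
    tendsto_integral_card_edgesBetween_sub_div hν h0
      (fun n => (A n).reduce k) (fun n => ((A n).map k)ᶜ)
  have hmain := (tendsto_sum_card_reduce_mul_card_map_compl_div A).mul_const (∫ x, x ∂ν)
  have hlim := ENNReal.tendsto_ofReal (hdev.add hmain)
  rw [Finset.sum_const_zero, zero_add] at hlim
  refine hlim.congr' ?_
  filter_upwards [eventually_gt_atTop 0] with n hn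
  rw [mul_lintegral_uncodedLoad hn hT, Finset.sum_sub_distrib, ← Finset.sum_mul, ← Finset.sum_div,
    ← Finset.sum_div, sub_add_cancel]

end UncodedLoad

section CodedLoad

variable {n K r T : ℕ} {ν : Measure ℝ}

lemma lintegral_minLoad_le (hn : 0 < n) (hT : 0 < T) (hr : 0 < r) {A : Allocation n K r}
    (hA : ∀ j, #(A.mappers j) = r) (μ : Measure (LoopGraph n)) [IsProbabilityMeasure μ]
    {x : Finset (Fin K) → Fin K → ℝ} {c : ℝ} (hx : ∀ S k, x S k ≤ c) :
    ∫⁻ G, minLoad T A G ∂μ ≤ ENNReal.ofReal ((r + 1) / r *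
      (∑ S ∈ Finset.univ.powersetCard (r + 1), (c + ∑ k ∈ S,
        ∫ G, |#(edgesBetween G (A.reduce k) (A.batch (S.erase k))) - x S k| ∂μ + r)) / n ^ 2) := by
  let dev (G : LoopGraph n) (S : Finset (Fin K)) (k : Fin K) : ℝ :=
    |#(edgesBetween G (A.reduce k) (A.batch (S.erase k))) - x S k|
  have hcard (G : LoopGraph n) (S : Finset (Fin K)) (k : Fin K) (hk : k ∈ S) :
      (#(edgesBetween G (A.reduce k) (A.batch (S.erase k))) : ℝ) ≤ c + ∑ k ∈ S, dev G S k := by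
    have hdev := Finset.single_le_sum (f := dev G S) (fun k _ => abs_nonneg _) hk
    have habs := le_abs_self ((#(edgesBetween G (A.reduce k) (A.batch (S.erase k))) : ℝ) - x S k)
    linarith [hx S k]
  have hnonneg (G : LoopGraph n) (S : Finset (Fin K)) (hS : S ∈ Finset.univ.powersetCard (r + 1)) :
      0 ≤ c + ∑ k ∈ S, dev G S k + r := by
    obtain ⟨k, hk⟩ : S.Nonempty :=
      Finset.card_pos.1 ((Finset.mem_powersetCard.1 hS).2 ▸ Nat.succ_pos r)
    exact add_nonneg ((Nat.cast_nonneg _).trans (hcard G S k hk)) (Nat.cast_nonneg r)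
  refine (lintegral_mono fun G => minLoad_le_of_card_edgesBetween_le hn hT hr hA _
    fun S _ k hk => hcard G S k hk).trans ?_
  rw [← ofReal_integral_eq_lintegral_ofReal .of_finite (.of_forall fun G => div_nonneg
    (mul_nonneg (by positivity) (Finset.sum_nonneg (hnonneg G))) (by positivity))]
  refine ENNReal.ofReal_le_ofReal (le_of_eq ?_)
  rw [integral_div, integral_const_mul, integral_finsetSum _ fun _ _ => .of_finite]
  congr 3
  funext S
  rw [integral_add .of_finite .of_finite, integral_add .of_finite .of_finite,
    integral_finsetSum _ fun _ _ => .of_finite]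
  simp only [integral_const, probReal_univ, one_smul, dev]

lemma succ_mul_choose_succ_div (hr : 0 < r) (hrK : r ≤ K) :
    ((r : ℝ) + 1) / r * (K.choose (r + 1) / (K * K.choose r)) = 1 / r * (1 - r / K) := by
  have hK : (K : ℝ) ≠ 0 := mod_cast (hr.trans_le hrK).ne'
  have hC : (K.choose r : ℝ) ≠ 0 := mod_cast (Nat.choose_pos hrK).ne'
  have h : (K.choose (r + 1) : ℝ) * (r + 1) = K.choose r * (K - r) := by
    rw [← Nat.cast_sub hrK]
    exact_mod_cast Nat.choose_succ_right_eq K r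
  have hr' : (r : ℝ) ≠ 0 := mod_cast hr.ne'
  field_simp
  linear_combination h

lemma tendsto_nat_div_add_div (k : ℕ) (a : ℝ) :
    Tendsto (fun n : ℕ => ((n / k : ℕ) + a) / n) atTop (𝓝 (1 / k)) := by
  have hfloor := (tendsto_nat_floor_mul_div_atTop (R := ℝ) (a := 1 / k) (by positivity)).comp
    tendsto_natCast_atTop_atTop
  rw [← add_zero (1 / (k : ℝ))]
  refine (hfloor.add (tendsto_const_div_atTop_nhds_zero_nat a)).congr fun n => ?_
  rw [Function.comp_apply, one_div_mul_eq_div, Nat.floor_div_eq_div, add_div]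

lemma tendsto_mul_sum_powersetCard_div (hr : 0 < r) (hrK : r ≤ K) {m : ℝ} {c : ℕ → ℝ}
    (hc : Tendsto (fun n : ℕ => c n / n) atTop (𝓝 (m / (K * K.choose r))))
    {dev : ℕ → Finset (Fin K) → Fin K → ℝ}
    (hdev : ∀ S k, Tendsto (fun n : ℕ => dev n S k / n) atTop (𝓝 0)) :
    Tendsto (fun n : ℕ => (r + 1) / r * ∑ S ∈ Finset.univ.powersetCard (r + 1),
      (c n + ∑ k ∈ S, dev n S k + r) / n) atTop (𝓝 (m * (1 / r * (1 - r / K)))) := by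
  have hsum (S : Finset (Fin K)) : Tendsto (fun n : ℕ => (c n + ∑ k ∈ S, dev n S k + r) / n) atTop
      (𝓝 (m / (K * K.choose r))) := by
    have h := (hc.add (tendsto_finsetSum S fun k _ => hdev S k)).add
      (tendsto_const_div_atTop_nhds_zero_nat (r : ℝ))
    simpa only [add_div, Finset.sum_div, Finset.sum_const_zero, add_zero] using h
  convert (tendsto_finsetSum (Finset.univ.powersetCard (r + 1)) fun S _ =>
    hsum S).const_mul (((r : ℝ) + 1) / r) using 2
  rw [← succ_mul_choose_succ_div hr hrK, Finset.sum_const, Finset.card_powersetCard,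
    Finset.card_univ, Fintype.card_fin, nsmul_eq_mul]
  ring

theorem limsup_mul_minAverageLoad_le [IsProbabilityMeasure ν] (hr : 0 < r) (hrK : r ≤ K)
    (hT : 0 < T) (hν : Integrable id ν) (h0 : ∀ᵐ x ∂ν, 0 ≤ x) :
    limsup (fun n : ℕ => (n : ℝ≥0∞) * minAverageLoad K r T (iidDegreeGraph n ν)) atTop ≤
      ENNReal.ofReal ((∫ x, x ∂ν) * (1 / r * (1 - r / K))) := by
  choose A hA hbatch using exists_allocation_card_batch_le hr hrK
  set m := ∫ x, x ∂ν
  have hm0 : 0 ≤ m := integral_nonneg_of_ae h0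
  let c (n : ℕ) : ℝ := ((n / K : ℕ) + 1) * ((n / K.choose r : ℕ) + K.choose r) * m / n
  let x (n : ℕ) (S : Finset (Fin K)) (k : Fin K) : ℝ :=
    #((A n).reduce k) * #((A n).batch (S.erase k)) * m / n
  let dev (n : ℕ) (S : Finset (Fin K)) (k : Fin K) : ℝ :=
    ∫ G, |#(edgesBetween G ((A n).reduce k) ((A n).batch (S.erase k))) - x n S k|
      ∂iidDegreeGraph n ν
  have hx (n : ℕ) (S : Finset (Fin K)) (k : Fin K) : x n S k ≤ c n := by
    have hR : (#((A n).reduce k) : ℝ) ≤ (n / K : ℕ) + 1 := mod_cast card_reduce_le (A n) k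
    have hB : (#((A n).batch (S.erase k)) : ℝ) ≤ (n / K.choose r : ℕ) + K.choose r :=
      mod_cast hbatch n _
    unfold x c
    gcongr
  have hc : Tendsto (fun n : ℕ => c n / n) atTop (𝓝 (m / (K * K.choose r))) := by
    convert ((tendsto_nat_div_add_div K 1).mul
      (tendsto_nat_div_add_div (K.choose r) (K.choose r))).mul_const m using 2 <;> ring
  have hlim := tendsto_mul_sum_powersetCard_div hr hrK hc (dev := dev) fun S k =>
    tendsto_integral_abs_card_edgesBetween_sub_div hν h0 _ _
  refine (limsup_le_limsup ?_).trans (ENNReal.tendsto_ofReal hlim).limsup_eq.le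
  filter_upwards [eventually_gt_atTop 0] with n hn
  calc (n : ℝ≥0∞) * minAverageLoad K r T (iidDegreeGraph n ν)
      ≤ n * ∫⁻ G, minLoad T (A n) G ∂iidDegreeGraph n ν := by gcongr; exact iInf_le _ (A n)
    _ ≤ n * ENNReal.ofReal ((r + 1) / r * (∑ S ∈ Finset.univ.powersetCard (r + 1),
          (c n + ∑ k ∈ S, dev n S k + r)) / n ^ 2) := by
        gcongr; exact lintegral_minLoad_le hn hT hr (hA n) _ (hx n)
    _ = _ := by
        rw [← ENNReal.ofReal_natCast n, ← ENNReal.ofReal_mul (by positivity), ← Finset.sum_div]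
        field_simp

end CodedLoad

section Pareto

variable {t a : ℝ}

lemma measurable_paretoPDF (t a : ℝ) : Measurable (paretoPDF t a) :=
  (measurable_paretoPDFReal t a).ennreal_ofReal

lemma ae_le_paretoMeasure (t a : ℝ) : ∀ᵐ x ∂paretoMeasure t a, t ≤ x := by
  rw [paretoMeasure, ae_withDensity_iff (measurable_paretoPDF t a)]
  exact .of_forall fun x hx => not_lt.1 fun h => hx (paretoPDF_of_lt h)

lemma toReal_paretoPDF_smul (ht : 0 < t) (ha : 0 ≤ a) :
    (fun x : ℝ => (paretoPDF t a x).toReal • x) =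
      (Set.Ici t).indicator fun x : ℝ => a * t ^ a * x ^ (-a) := by
  funext x
  rw [paretoPDF, ENNReal.toReal_ofReal (paretoPDFReal_nonneg ht.le ha x), paretoPDFReal]
  by_cases hx : t ≤ x
  · rw [if_pos hx, Set.indicator_of_mem (Set.mem_Ici.2 hx), smul_eq_mul, mul_assoc,
      ← Real.rpow_add_one (ht.trans_le hx).ne', neg_add, neg_add_cancel_right]
  · rw [if_neg hx, Set.indicator_of_notMem (mt Set.mem_Ici.1 hx), zero_smul]

lemma integrable_id_paretoMeasure (ht : 0 < t) (ha : 1 < a) :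
    Integrable id (paretoMeasure t a) := by
  rw [paretoMeasure, integrable_withDensity_iff_integrable_smul'
    (measurable_paretoPDF t a) (.of_forall fun _ => ENNReal.ofReal_lt_top)]
  simp only [id]
  rw [toReal_paretoPDF_smul ht (by linarith), integrable_indicator_iff measurableSet_Ici,
    integrableOn_Ici_iff_integrableOn_Ioi]
  exact (integrableOn_Ioi_rpow_of_lt (by linarith) ht).const_mul _

lemma integral_id_paretoMeasure (ht : 0 < t) (ha : 1 < a) :
    ∫ x, x ∂paretoMeasure t a = a * t / (a - 1) := by
  have hrpow : t ^ a * t ^ (-(a - 1)) = t := by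
    rw [← Real.rpow_add ht, neg_sub, add_sub_cancel, Real.rpow_one]
  rw [paretoMeasure, integral_withDensity_eq_integral_toReal_smul
    (measurable_paretoPDF t a) (.of_forall fun _ => ENNReal.ofReal_lt_top),
    toReal_paretoPDF_smul ht (by linarith), integral_indicator measurableSet_Ici,
    integral_Ici_eq_integral_Ioi, integral_const_mul, integral_Ioi_rpow_of_lt (by linarith) ht,
    neg_add_eq_sub, ← neg_sub a 1, neg_div_neg_eq, mul_assoc, mul_div_assoc', hrpow,
    mul_div_assoc']

end Pareto
end CodedGraph

theorem theorem4_general (K r T : ℕ) (hr : 1 ≤ r) (hrK : r ≤ K) (hT : 0 < T) (ν : Measure ℝ)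
    [IsProbabilityMeasure ν] (hν : Integrable id ν) (h0 : ∀ᵐ x ∂ν, 0 ≤ x)
    (hm : 0 < ∫ x, x ∂ν) :
    limsup (fun n : ℕ => (n : ℝ≥0∞) *
        CodedGraph.minAverageLoad K r T (CodedGraph.iidDegreeGraph n ν) /
          ENNReal.ofReal (∫ x, x ∂ν)) atTop
      ≤ ENNReal.ofReal (1 / (r : ℝ) * (1 - (r : ℝ) / (K : ℝ))) ∧
    ∀ A : (n : ℕ) → CodedGraph.Allocation n K r,
      Tendsto (fun n : ℕ => (n : ℝ≥0∞) *
          ∫⁻ G, CodedGraph.uncodedLoad T (A n) G ∂(CodedGraph.iidDegreeGraph n ν)) atTop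
        (𝓝 (ENNReal.ofReal ((1 - (r : ℝ) / (K : ℝ)) * ∫ x, x ∂ν))) := by
  refine ⟨?_, CodedGraph.tendsto_mul_lintegral_uncodedLoad hT hν h0⟩
  have hm' : ENNReal.ofReal (∫ x, x ∂ν) ≠ 0 := (ENNReal.ofReal_pos.2 hm).ne'
  simp_rw [div_eq_mul_inv (_ * _)]
  rw [ENNReal.limsup_mul_const_of_ne_top (ENNReal.inv_ne_top.2 hm'), ← ENNReal.div_eq_inv_mul]
  refine ENNReal.div_le_of_le_mul' ?_
  rw [← ENNReal.ofReal_mul hm.le]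
  exact CodedGraph.limsup_mul_minAverageLoad_le hr hrK hT hν h0

theorem theorem4 (K r T : ℕ) (hr : 1 ≤ r) (hrK : r ≤ K) (hT : 0 < T) (γ : ℝ) (hγ : 2 < γ) :
    limsup (fun n : ℕ => (n : ℝ≥0∞) *
        CodedGraph.minAverageLoad K r T (CodedGraph.powerLawGraph n γ) /
          ENNReal.ofReal ((γ - 1) / (γ - 2))) atTop
      ≤ ENNReal.ofReal (1 / (r : ℝ) * (1 - (r : ℝ) / (K : ℝ))) ∧
    ∀ A : (n : ℕ) → CodedGraph.Allocation n K r,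
      Tendsto (fun n : ℕ => (n : ℝ≥0∞) *
          ∫⁻ G, CodedGraph.uncodedLoad T (A n) G ∂(CodedGraph.powerLawGraph n γ)) atTop
        (𝓝 (ENNReal.ofReal ((1 - (r : ℝ) / (K : ℝ)) * ((γ - 1) / (γ - 2))))) := by
  have hγ1 : 1 < γ - 1 := by linarith
  have := isProbabilityMeasure_paretoMeasure one_pos (one_pos.trans hγ1)
  have hmean : ∫ x, x ∂paretoMeasure 1 (γ - 1) = (γ - 1) / (γ - 2) := by
    rw [CodedGraph.integral_id_paretoMeasure one_pos hγ1]
    ring_nf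
  rw [← hmean]
  exact theorem4_general K r T hr hrK hT _ (CodedGraph.integrable_id_paretoMeasure one_pos hγ1)
    ((CodedGraph.ae_le_paretoMeasure 1 _).mono fun x => zero_le_one.trans)
    (hmean ▸ div_pos (by linarith) (by linarith))
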